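/- Let $n\ge 1$ and let $\mathcal S_n$ be the set of all permutations of $\{1,\dots,n\}$. For $\pi\in\mathcal S_n$ let $$\mathrm{exc}(\pi)=\#\{i : \pi(i)>i\},\qquad \mathrm{inv}(\pi)=\#\{(i,j) : i<j,\ \pi(i)>\pi(j)\}$$ be the numbers of excedances and of inversions of $\pi$, and for integers $e,k$ let $$S_n^{(\mathrm{exc},\mathrm{inv})}(e,k)=\#\{\pi\in\mathcal S_n : \mathrm{exc}(\pi)=e,\ \mathrm{inv}(\pi)=k\}.$$ Then for all integers $e$ and $k$, $$S_n^{(\mathrm{exc},\mathrm{inv})}(e,k)=S_n^{(\mathrm{exc},\mathrm{inv})}(n-1-e,\;n-1-2e+k).$$ -/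

import Mathlib

namespace PermStat

/-- The set of excedances of a permutation: the positions `i` with `π i > i`.
Permutations of `{1, …, n}` are modelled as permutations of `Fin n = {0, …, n - 1}`; the shift of
indices by one changes none of the comparisons, and the last position is never an excedance. -/
def excedances {n : ℕ} (π : Equiv.Perm (Fin n)) : Finset (Fin n) :=
  Finset.univ.filter (fun i => i < π i)

/-- The set of inversions of a permutation, an inversion `(π i, π j)` being recorded by its pair
of positions `(i, j)`, with `i < j` and `π i > π j`. -/
def inversions {n : ℕ} (π : Equiv.Perm (Fin n)) : Finset (Fin n × Fin n) :=
  Finset.univ.filter (fun p => p.1 < p.2 ∧ π p.2 < π p.1)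

/-- The number of excedances. -/
def exc {n : ℕ} (π : Equiv.Perm (Fin n)) : ℕ := (excedances π).card

/-- The number of inversions. -/
def inv {n : ℕ} (π : Equiv.Perm (Fin n)) : ℕ := (inversions π).card

/-- The coefficient of the joint distribution of two statistics `f` and `g` on the symmetric
group: the number of permutations `π` with `f π = k` and `g π = l`. The values `k`, `l` range over
all integers, so the coefficient is zero at values that are not attained. -/
def jointCoeff {n : ℕ} (f g : Equiv.Perm (Fin n) → ℕ) (k l : ℤ) : ℕ :=
  (Finset.univ.filter (fun π : Equiv.Perm (Fin n) => (f π : ℤ) = k ∧ (g π : ℤ) = l)).card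

end PermStat

namespace PermStat

open Finset

/-! With d = inv − exc, the claim is that exc ↦ n − 1 − exc preserves the joint distribution of
(exc, d). It is proved more generally for permutations with no point in the corner box h × (h + 1).
Enlarging the box by a row or a column discards only permutations with a point in the added line,
and deleting that point changes exc and d by amounts independent of the rest (`boxSum_row`,
`boxSum_col`). In `boxSum_rec` the one-point deletions pair up, with equal change of d, one losing
an excedance and one not; the two-point deletions lose exactly one excedance. Both patterns respect
the reflection, so `boxSum_symm` follows by induction. -/

/-- The permutation of `Fin (n + 1)` that sends `a` to `b` and is order-isomorphic to `τ` away from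
`a`. -/
def insertAt {n : ℕ} (a b : Fin (n + 1)) (τ : Equiv.Perm (Fin n)) : Equiv.Perm (Fin (n + 1)) :=
  ((finSuccEquiv' a).trans (Equiv.optionCongr τ)).trans (finSuccEquiv' b).symm

@[simp]
lemma insertAt_self {n : ℕ} (a b : Fin (n + 1)) (τ : Equiv.Perm (Fin n)) :
    insertAt a b τ a = b := by
  simp [insertAt]

@[simp]
lemma insertAt_succAbove {n : ℕ} (a b : Fin (n + 1)) (τ : Equiv.Perm (Fin n)) (i : Fin n) :
    insertAt a b τ (a.succAbove i) = b.succAbove (τ i) := by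
  simp [insertAt]

lemma insertAt_injective {n : ℕ} (a b : Fin (n + 1)) : Function.Injective (insertAt a b) := by
  intro τ τ' h
  ext i
  have := congrArg (fun σ => σ (a.succAbove i)) h
  simp only [insertAt_succAbove] at this
  rw [Fin.succAbove_right_injective this]

lemma exists_insertAt {n : ℕ} (a : Fin (n + 1)) (σ : Equiv.Perm (Fin (n + 1))) :
    ∃ τ, insertAt a (σ a) τ = σ := by
  have h : ∀ i, ∃ j, (σ a).succAbove j = σ (a.succAbove i) := fun i =>
    Fin.exists_succAbove_eq (σ.injective.ne (Fin.succAbove_ne a i))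
  choose t ht using h
  have hinj : Function.Injective t := by
    intro i j hij
    have := ht i
    rw [hij, ht j] at this
    exact (Fin.succAbove_right_injective (σ.injective this)).symm
  refine ⟨Equiv.ofBijective t (Finite.injective_iff_bijective.mp hinj), ?_⟩
  ext i
  rcases Fin.eq_self_or_eq_succAbove a i with rfl | ⟨j, rfl⟩
  · simp
  · simp [ht]

lemma sum_apply_eq {n : ℕ} (a b : Fin (n + 1)) (F : Equiv.Perm (Fin (n + 1)) → ℕ) :
    ∑ σ, (if σ a = b then F σ else 0) = ∑ τ, F (insertAt a b τ) := by
  rw [← Finset.sum_filter]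
  symm
  refine Finset.sum_bij (fun τ _ => insertAt a b τ) (by simp)
    (fun _ _ _ _ h => insertAt_injective a b h) ?_ (fun _ _ => rfl)
  intro σ hσ
  obtain ⟨τ, hτ⟩ := exists_insertAt a σ
  rw [(Finset.mem_filter.mp hσ).2] at hτ
  exact ⟨τ, Finset.mem_univ _, hτ⟩

lemma exc_eq_sum {n : ℕ} (σ : Equiv.Perm (Fin n)) :
    exc σ = ∑ i, if i < σ i then 1 else 0 := by
  simp [exc, excedances]

lemma inv_eq_sum {n : ℕ} (σ : Equiv.Perm (Fin n)) :
    inv σ = ∑ i, ∑ j, if i < j ∧ σ j < σ i then 1 else 0 := by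
  rw [← Fintype.sum_prod_type' (fun i j : Fin n => if i < j ∧ σ j < σ i then 1 else 0)]
  simp [inv, inversions]

lemma exc_insertAt {n : ℕ} (a b : Fin (n + 1)) (τ : Equiv.Perm (Fin n)) :
    exc (insertAt a b τ) = (if a < b then 1 else 0) +
      ∑ i, if a.succAbove i < b.succAbove (τ i) then 1 else 0 := by
  rw [exc_eq_sum, Fin.sum_univ_succAbove _ a]
  simp

lemma inv_insertAt {n : ℕ} (a b : Fin (n + 1)) (τ : Equiv.Perm (Fin n)) :
    inv (insertAt a b τ) = inv τ +
      (∑ i, if a < a.succAbove i ∧ b.succAbove (τ i) < b then 1 else 0) +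
      ∑ i, if a.succAbove i < a ∧ b < b.succAbove (τ i) then 1 else 0 := by
  rw [inv_eq_sum, inv_eq_sum, Fin.sum_univ_succAbove _ a, Fin.sum_univ_succAbove _ a]
  simp only [Fin.sum_univ_succAbove _ a, insertAt_self, insertAt_succAbove, lt_irrefl, false_and,
    if_false, zero_add, Finset.sum_add_distrib, Fin.succAbove_lt_succAbove_iff]
  ring

lemma lt_succAbove_iff {n : ℕ} (a : Fin (n + 1)) (i : Fin n) :
    a < a.succAbove i ↔ a.val ≤ i.val := by
  rw [Fin.lt_succAbove_iff_le_castSucc]; rfl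

lemma succAbove_lt_iff {n : ℕ} (a : Fin (n + 1)) (i : Fin n) :
    a.succAbove i < a ↔ i.val < a.val := by
  rw [Fin.succAbove_lt_iff_castSucc_lt]; rfl

lemma succAbove_val {n : ℕ} (a : Fin (n + 1)) (i : Fin n) :
    (a.succAbove i).val = if i.val < a.val then i.val else i.val + 1 := by
  simp only [Fin.succAbove, Fin.lt_def, Fin.val_castSucc]
  split_ifs <;> simp

lemma sum_val_lt {n m : ℕ} (h : m ≤ n) : ∑ i : Fin n, (if i.val < m then 1 else 0) = m := by
  rw [Fin.sum_univ_eq_sum_range (fun i => if i < m then 1 else 0) n, ← Finset.sum_filter]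
  have : (range n).filter (· < m) = range m := by ext; simp; omega
  simp [this]

lemma sum_apply_val_lt {n m : ℕ} (τ : Equiv.Perm (Fin n)) (h : m ≤ n) :
    ∑ i : Fin n, (if (τ i).val < m then 1 else 0) = m := by
  rw [Equiv.sum_comp τ (fun i : Fin n => if i.val < m then 1 else 0), sum_val_lt h]

/-- `σ` has no point in the box `{i < a} × {j < b}`. -/
def AvoidsBox {n : ℕ} (a b : ℕ) (σ : Equiv.Perm (Fin n)) : Prop :=
  ∀ i : Fin n, i.val < a → b ≤ (σ i).val

open Classical in
/-- The sum of `g (exc σ) (inv σ - exc σ)` over the permutations `σ` avoiding a box. -/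
noncomputable def boxSum (a b n : ℕ) (g : ℤ → ℤ → ℕ) : ℕ :=
  ∑ σ : Equiv.Perm (Fin n), if AvoidsBox a b σ then g (exc σ) (inv σ - exc σ) else 0

lemma avoidsBox_insertAt_row {n h j : ℕ} (hn : h < n + 1) (hj : j < h + 1)
    (τ : Equiv.Perm (Fin n)) :
    AvoidsBox h (h + 1) (insertAt ⟨h, hn⟩ ⟨j, by omega⟩ τ) ↔ AvoidsBox h h τ := by
  simp only [AvoidsBox, Fin.forall_iff_succAbove (⟨h, hn⟩ : Fin (n + 1)), insertAt_self,
    insertAt_succAbove, succAbove_val, lt_irrefl, false_imp_iff, true_and]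
  refine forall_congr' fun i => ?_
  split_ifs <;> omega

lemma avoidsBox_insertAt_col {n h i : ℕ} (hn : h + 1 < n + 1) (hi : i < h + 1)
    (τ : Equiv.Perm (Fin n)) :
    AvoidsBox (h + 1) (h + 1) (insertAt ⟨i, by omega⟩ ⟨h + 1, hn⟩ τ) ↔ AvoidsBox h (h + 1) τ := by
  simp only [AvoidsBox, Fin.forall_iff_succAbove (⟨i, by omega⟩ : Fin (n + 1)), insertAt_self,
    insertAt_succAbove, succAbove_val, le_refl, imp_true_iff, true_and]
  refine forall_congr' fun i => ?_
  split_ifs <;> omega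

/-- Entries before position h are excedances before and after; an entry shifted in position but not
in value has value < j ≤ h, so it is never one. -/
lemma exc_insertAt_row {n h j : ℕ} (hn : h < n + 1) (hj : j < h + 1)
    {τ : Equiv.Perm (Fin n)} (hτ : AvoidsBox h h τ) :
    exc (insertAt ⟨h, hn⟩ ⟨j, by omega⟩ τ) = exc τ := by
  rw [exc_insertAt, exc_eq_sum, if_neg (by simp; omega), zero_add]
  refine Finset.sum_congr rfl fun i _ => if_congr ?_ rfl rfl
  have := hτ i
  simp only [Fin.lt_def, succAbove_val]
  split_ifs <;> omega

/-- Since the box is empty, all j values below j lie to the right of the new point, and all h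
entries to its left exceed it. -/
lemma inv_insertAt_row {n h j : ℕ} (hn : h < n + 1) (hj : j < h + 1)
    {τ : Equiv.Perm (Fin n)} (hτ : AvoidsBox h h τ) :
    inv (insertAt ⟨h, hn⟩ ⟨j, by omega⟩ τ) = inv τ + j + h := by
  rw [inv_insertAt]
  congr 2
  · refine Eq.trans (Finset.sum_congr rfl fun i _ => if_congr ?_ rfl rfl)
      (sum_apply_val_lt τ (by omega : j ≤ n))
    have := hτ i
    simp only [lt_succAbove_iff, succAbove_lt_iff]
    omega
  · refine Eq.trans (Finset.sum_congr rfl fun i _ => if_congr ?_ rfl rfl)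
      (sum_val_lt (by omega : h ≤ n))
    have := hτ i
    simp only [lt_succAbove_iff, succAbove_lt_iff]
    omega

lemma exc_insertAt_col {n h i : ℕ} (hn : h + 1 < n + 1) (hi : i < h + 1)
    {τ : Equiv.Perm (Fin n)} (hτ : AvoidsBox h (h + 1) τ) :
    exc (insertAt ⟨i, by omega⟩ ⟨h + 1, hn⟩ τ) = exc τ + 1 := by
  rw [exc_insertAt, exc_eq_sum, if_pos (by simp; omega), add_comm]
  congr 1
  refine Finset.sum_congr rfl fun i _ => if_congr ?_ rfl rfl
  have := hτ i
  simp only [Fin.lt_def, succAbove_val]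
  split_ifs <;> omega

/-- All h + 1 smaller values lie to the right and all i entries to the left are larger. As exc grows
by one, d grows by h + i, matching the row insertion. -/
lemma inv_insertAt_col {n h i : ℕ} (hn : h + 1 < n + 1) (hi : i < h + 1)
    {τ : Equiv.Perm (Fin n)} (hτ : AvoidsBox h (h + 1) τ) :
    inv (insertAt ⟨i, by omega⟩ ⟨h + 1, hn⟩ τ) = inv τ + (h + 1) + i := by
  rw [inv_insertAt]
  congr 2
  · refine Eq.trans (Finset.sum_congr rfl fun i _ => if_congr ?_ rfl rfl)
      (sum_apply_val_lt τ (by omega : h + 1 ≤ n))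
    have := hτ i
    simp only [lt_succAbove_iff, succAbove_lt_iff]
    omega
  · refine Eq.trans (Finset.sum_congr rfl fun i _ => if_congr ?_ rfl rfl)
      (sum_val_lt (by omega : i ≤ n))
    have := hτ i
    simp only [lt_succAbove_iff, succAbove_lt_iff]
    omega

lemma boxSum_row {n h : ℕ} (hn : h < n + 1) (g : ℤ → ℤ → ℕ) :
    boxSum h (h + 1) (n + 1) g = boxSum (h + 1) (h + 1) (n + 1) g +
      ∑ j ∈ range (h + 1), boxSum h h n (fun e d => g e (d + h + j)) := by
  classical
  have key : ∀ j ∈ range (h + 1), boxSum h h n (fun e d => g e (d + h + j)) =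
      ∑ σ : Equiv.Perm (Fin (n + 1)), if (σ ⟨h, hn⟩).val = j then
        (if AvoidsBox h (h + 1) σ then g (exc σ) (inv σ - exc σ) else 0) else 0 := by
    intro j hj
    have hj := Finset.mem_range.mp hj
    have := sum_apply_eq (⟨h, hn⟩ : Fin (n + 1)) ⟨j, by omega⟩
      (fun σ => if AvoidsBox h (h + 1) σ then g (exc σ) (inv σ - exc σ) else 0)
    simp only [Fin.ext_iff] at this
    rw [this, boxSum]
    refine Finset.sum_congr rfl fun τ _ => ?_
    rw [avoidsBox_insertAt_row hn hj]
    split_ifs with hτ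
    · rw [exc_insertAt_row hn hj hτ, inv_insertAt_row hn hj hτ]
      congr 1
      push_cast
      ring
    · rfl
  rw [Finset.sum_congr rfl key, Finset.sum_comm, boxSum, boxSum, ← Finset.sum_add_distrib]
  refine Finset.sum_congr rfl fun σ _ => ?_
  rw [Finset.sum_ite_eq]
  have hiff : AvoidsBox (h + 1) (h + 1) σ ↔
      AvoidsBox h (h + 1) σ ∧ h + 1 ≤ (σ ⟨h, hn⟩).val := by
    refine ⟨fun H => ⟨fun i hi => H i (by omega), H _ (by simp)⟩, fun H i hi => ?_⟩
    rcases Nat.lt_succ_iff_lt_or_eq.mp hi with hi | rfl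
    · exact H.1 i hi
    · exact H.2
  simp only [Finset.mem_range, hiff]
  by_cases h1 : AvoidsBox h (h + 1) σ <;> by_cases h2 : (σ ⟨h, hn⟩).val < h + 1 <;>
    simp [h1, h2, not_le.mpr, not_lt.mp]

lemma boxSum_col {n h : ℕ} (hn : h + 1 < n + 1) (g : ℤ → ℤ → ℕ) :
    boxSum (h + 1) (h + 1) (n + 1) g = boxSum (h + 1) (h + 2) (n + 1) g +
      ∑ i ∈ range (h + 1), boxSum h (h + 1) n (fun e d => g (e + 1) (d + h + i)) := by
  classical
  have key : ∀ i ∈ range (h + 1), boxSum h (h + 1) n (fun e d => g (e + 1) (d + h + i)) =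
      ∑ σ : Equiv.Perm (Fin (n + 1)), if (σ.symm ⟨h + 1, hn⟩).val = i then
        (if AvoidsBox (h + 1) (h + 1) σ then g (exc σ) (inv σ - exc σ) else 0) else 0 := by
    intro i hi
    have hi := Finset.mem_range.mp hi
    have := sum_apply_eq (⟨i, by omega⟩ : Fin (n + 1)) ⟨h + 1, hn⟩
      (fun σ => if AvoidsBox (h + 1) (h + 1) σ then g (exc σ) (inv σ - exc σ) else 0)
    have hsymm : ∀ σ : Equiv.Perm (Fin (n + 1)),
        (σ.symm ⟨h + 1, hn⟩).val = i ↔ σ ⟨i, by omega⟩ = ⟨h + 1, hn⟩ := by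
      intro σ
      rw [eq_comm (a := σ _), ← Equiv.symm_apply_eq, Fin.ext_iff]
    simp only [hsymm]
    rw [this, boxSum]
    refine Finset.sum_congr rfl fun τ _ => ?_
    rw [avoidsBox_insertAt_col hn hi]
    split_ifs with hτ
    · rw [exc_insertAt_col hn hi hτ, inv_insertAt_col hn hi hτ]
      congr 1
      push_cast
      ring
    · rfl
  rw [Finset.sum_congr rfl key, Finset.sum_comm, boxSum, boxSum, ← Finset.sum_add_distrib]
  refine Finset.sum_congr rfl fun σ _ => ?_
  rw [Finset.sum_ite_eq]
  have hiff : AvoidsBox (h + 1) (h + 2) σ ↔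
      AvoidsBox (h + 1) (h + 1) σ ∧ h + 1 ≤ (σ.symm ⟨h + 1, hn⟩).val := by
    refine ⟨fun H => ⟨fun i hi => by have := H i hi; omega, ?_⟩, fun H i hi => ?_⟩
    · by_contra! hlt
      have := H _ hlt
      simp at this
    · refine lt_of_le_of_ne (H.1 i hi) fun heq => ?_
      have : σ i = ⟨h + 1, hn⟩ := Fin.ext heq.symm
      rw [← this, Equiv.symm_apply_apply] at H
      omega
  simp only [Finset.mem_range, hiff]
  by_cases h1 : AvoidsBox (h + 1) (h + 1) σ <;>
    by_cases h2 : (σ.symm ⟨h + 1, hn⟩).val < h + 1 <;> simp [h1, h2, not_le.mpr, not_lt.mp]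

lemma boxSum_eq_zero {a b n : ℕ} (ha : 0 < a) (hn : 0 < n) (hb : n ≤ b) (g : ℤ → ℤ → ℕ) :
    boxSum a b n g = 0 := by
  refine Finset.sum_eq_zero fun σ _ => if_neg fun H => ?_
  have := H ⟨0, hn⟩ ha
  have := (σ ⟨0, hn⟩).isLt
  omega

lemma boxSum_zero_left (b c n : ℕ) (g : ℤ → ℤ → ℕ) : boxSum 0 b n g = boxSum 0 c n g := by
  simp [boxSum, AvoidsBox]

/-- Recurrence in which the steps that keep `h` come in pairs with and without an excedance. -/
lemma boxSum_rec {n h : ℕ} (hn : h < n + 1) (g : ℤ → ℤ → ℕ) :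
    boxSum h (h + 1) (n + 2) g = boxSum (h + 1) (h + 2) (n + 2) g +
      (∑ i ∈ range (h + 1), boxSum h (h + 1) (n + 1) (fun e d => g (e + 1) (d + h + i)) +
      ∑ j ∈ range (h + 1), boxSum h (h + 1) (n + 1) (fun e d => g e (d + h + j)) +
      ∑ j ∈ range (h + 1), ∑ i ∈ range h,
        boxSum (h - 1) h n (fun e d => g (e + 1) (d + (h - 1 : ℕ) + i + h + j))) := by
  -- For h = 0 both boxes and the range of summation are empty, so the truncated `h - 1` is
  -- harmless.
  have hZ : ∀ G, boxSum h h (n + 1) G = boxSum h (h + 1) (n + 1) G +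
      ∑ i ∈ range h, boxSum (h - 1) h n (fun e d => G (e + 1) (d + (h - 1 : ℕ) + i)) := by
    intro G
    cases h with
    | zero => simp [boxSum_zero_left 0 1]
    | succ h => exact boxSum_col (by omega) G
  rw [boxSum_row (by omega), boxSum_col (by omega)]
  simp only [hZ, Finset.sum_add_distrib, add_assoc]

theorem boxSum_symm (n : ℕ) : ∀ (h : ℕ) (g : ℤ → ℤ → ℕ),
    boxSum h (h + 1) (n + 1) g = boxSum h (h + 1) (n + 1) (fun e d => g (n - e) d) := by
  induction n using Nat.strong_induction_on with
  | _ n ih =>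
    -- The recurrence also calls a larger box at the same size, so an inner induction runs downward
    -- on h; m bounds n + 1 − h.
    suffices H : ∀ m h, n + 1 ≤ h + m → ∀ g : ℤ → ℤ → ℕ,
        boxSum h (h + 1) (n + 1) g = boxSum h (h + 1) (n + 1) (fun e d => g (n - e) d) from
      fun h g => H (n + 1) h (by omega) g
    intro m
    induction m with
    | zero =>
      intro h hm g
      rw [boxSum_eq_zero (by omega) (by omega) (by omega),
        boxSum_eq_zero (by omega) (by omega) (by omega)]
    | succ m ihm =>
      intro h hm g
      rcases n with _ | n
      · rcases h with _ | h
        · simp [boxSum, exc, excedances]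
        · rw [boxSum_eq_zero (by omega) (by omega) (by omega),
            boxSum_eq_zero (by omega) (by omega) (by omega)]
      by_cases hlt : h < n + 1
      swap
      · rw [boxSum_eq_zero (by omega) (by omega) (by omega),
          boxSum_eq_zero (by omega) (by omega) (by omega)]
      rw [boxSum_rec hlt, boxSum_rec hlt, ihm (h + 1) (by omega)]
      congr 1
      -- One point fewer means reflecting by n instead of n + 1, which exchanges the shifts e and e
      -- + 1.
      · rw [add_comm (∑ i ∈ range (h + 1), boxSum h (h + 1) (n + 1) _)]
        congr 1
        · congr 1
          · refine Finset.sum_congr rfl fun i _ => ?_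
            rw [ih n (by omega)]
            congr! 4
            push_cast
            ring
          · refine Finset.sum_congr rfl fun i _ => ?_
            rw [ih n (by omega)]
            congr! 4
            push_cast
            ring
        -- Here (n + 1) − (e + 1) = (n − 1 − e) + 1, so each term is its own reflection.
        · refine Finset.sum_congr rfl fun j _ => Finset.sum_congr rfl fun i hi => ?_
          have := Finset.mem_range.mp hi
          obtain ⟨h, rfl⟩ := Nat.exists_eq_add_one_of_ne_zero (by omega : h ≠ 0)
          obtain ⟨n, rfl⟩ := Nat.exists_eq_add_one_of_ne_zero (by omega : n ≠ 0)
          rw [Nat.add_sub_cancel, ih n (by omega)]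
          congr! 4
          push_cast
          ring

lemma jointCoeff_eq_boxSum (n : ℕ) (e k : ℤ) :
    jointCoeff (n := n) exc inv e k =
      boxSum 0 1 n (fun x d => if x = e ∧ d = k - e then 1 else 0) := by
  simp only [jointCoeff, boxSum, AvoidsBox, Nat.not_lt_zero, false_imp_iff, implies_true, if_true,
    Finset.card_filter]
  refine Finset.sum_congr rfl fun σ _ => if_congr ?_ rfl rfl
  omega

end PermStat

theorem corollary6p5 (n : ℕ) (hn : 1 ≤ n) (e k : ℤ) :
    PermStat.jointCoeff (n := n) PermStat.exc PermStat.inv e k =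
      PermStat.jointCoeff (n := n) PermStat.exc PermStat.inv
        ((n : ℤ) - 1 - e) ((n : ℤ) - 1 - 2 * e + k) := by
  obtain ⟨n, rfl⟩ := Nat.exists_eq_add_one_of_ne_zero (by omega : n ≠ 0)
  rw [PermStat.jointCoeff_eq_boxSum, PermStat.jointCoeff_eq_boxSum, PermStat.boxSum_symm]
  congr! 4
  push_cast
  omega
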